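/- Let $d\geq 2$. By a $d$-dimensional polytope in $\mathbb{R}^d$ we mean the convex hull of a finite subset of $\mathbb{R}^d$ whose affine hull is $\mathbb{R}^d$; it is a lattice polytope if all its vertices belong to $\mathbb{Z}^d$. Let $P$ be such a polytope with vertex set $\mathcal{V}$. A point $x\in\mathbb{R}^d\setminus P$ can be inserted in $P$ if the convex hull of $P\cup\{x\}$ has vertex set $\mathcal{V}\cup\{x\}$; the insertion move then transforms $P$ into the convex hull of $P\cup\{x\}$. A vertex $v\in\mathcal{V}$ can be deleted from $P$ if the convex hull of $\mathcal{V}\setminus\{v\}$ is $d$-dimensional; the deletion move then transforms $P$ into the convex hull of $\mathcal{V}\setminus\{v\}$. Let $\Gamma(d)$ be the graph whose vertices are the $d$-dimensional polytopes contained in $\mathbb{R}^d$ and whose edges connect any two polytopes that can be obtained from one another by an insertion or a deletion move, and let $\Lambda(d)$ be the subgraph induced in $\Gamma(d)$ by the lattice polytopes. **Theorem.** For every $d\geq 2$, the graph $\Lambda(d)$ is connected, and the subgraph induced in $\Lambda(d)$ by the simplices and the polytopes with exactly $d+2$ vertices is connected. -/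

import Mathlib

namespace PolytopeMoves

/-- `P` is a `d`-dimensional polytope contained in `ℝ^d`: the convex hull of a finite set of points,
whose affine hull is the whole space. -/
def IsFullPolytope {d : ℕ} (P : Set (EuclideanSpace ℝ (Fin d))) : Prop :=
  (∃ s : Set (EuclideanSpace ℝ (Fin d)), s.Finite ∧ P = convexHull ℝ s) ∧
    affineSpan ℝ P = ⊤

/-- The type of the `d`-dimensional polytopes contained in `ℝ^d`. -/
abbrev Polytope (d : ℕ) : Type :=
  {P : Set (EuclideanSpace ℝ (Fin d)) // IsFullPolytope P}

/-- The vertex set of a polytope: its extreme points. -/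
def Polytope.vertices {d : ℕ} (P : Polytope d) : Set (EuclideanSpace ℝ (Fin d)) :=
  Set.extremePoints ℝ P.1

/-- The point `x`, outside of `P`, can be inserted in `P`: the vertex set of the convex hull
of `P ∪ {x}` is the vertex set of `P` together with `x`. -/
def CanInsert {d : ℕ} (P : Polytope d) (x : EuclideanSpace ℝ (Fin d)) : Prop :=
  x ∉ P.1 ∧ Set.extremePoints ℝ (convexHull ℝ (P.1 ∪ {x})) = P.vertices ∪ {x}

/-- The vertex `v` can be deleted from `P`: the convex hull of the other vertices is still a
`d`-dimensional polytope. -/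
def CanDelete {d : ℕ} (P : Polytope d) (v : EuclideanSpace ℝ (Fin d)) : Prop :=
  v ∈ P.vertices ∧ IsFullPolytope (convexHull ℝ (P.vertices \ {v}))

/-- `Q` is obtained from `P` by an insertion move. -/
def IsInsertionMove {d : ℕ} (P Q : Polytope d) : Prop :=
  ∃ x, CanInsert P x ∧ Q.1 = convexHull ℝ (P.1 ∪ {x})

/-- `Q` is obtained from `P` by a deletion move. -/
def IsDeletionMove {d : ℕ} (P Q : Polytope d) : Prop :=
  ∃ v, CanDelete P v ∧ Q.1 = convexHull ℝ (P.vertices \ {v})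

/-- `Q` is obtained from `P` by an insertion move or a deletion move. -/
def IsMove {d : ℕ} (P Q : Polytope d) : Prop :=
  IsInsertionMove P Q ∨ IsDeletionMove P Q

theorem not_isMove_self {d : ℕ} (P : Polytope d) : ¬ IsMove P P := by
  rintro (⟨x, hx, h⟩ | ⟨v, hv, h⟩)
  · apply hx.1
    rw [h]
    exact subset_convexHull ℝ _ (Or.inr rfl)
  · have hmem : v ∈ convexHull ℝ (P.vertices \ {v}) := h ▸ hv.1.1
    have hext : v ∈ Set.extremePoints ℝ (convexHull ℝ (P.vertices \ {v})) := h ▸ hv.1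
    exact (extremePoints_convexHull_subset hext).2 rfl

/-- The graph `Γ(d)`: its vertices are the `d`-dimensional polytopes contained in `ℝ^d`, and its
edges connect any two polytopes that are obtained from one another by an insertion move or a
deletion move. -/
def Gamma (d : ℕ) : SimpleGraph (Polytope d) where
  Adj P Q := IsMove P Q ∨ IsMove Q P
  symm := ⟨fun _ _ h => h.symm⟩
  loopless := ⟨fun P h => h.elim (not_isMove_self P) (not_isMove_self P)⟩

/-- A lattice polytope: all its vertices belong to `ℤ^d`. -/
def Polytope.IsLattice {d : ℕ} (P : Polytope d) : Prop :=
  ∀ v ∈ P.vertices, ∀ i : Fin d, ∃ n : ℤ, v i = (n : ℝ)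

/-- A simplex: a polytope whose vertices are affinely independent. -/
def Polytope.IsSimplex {d : ℕ} (P : Polytope d) : Prop :=
  AffineIndependent ℝ (fun v : P.vertices => (v : EuclideanSpace ℝ (Fin d)))

/-- The graph `Λ(d)`: the subgraph induced in `Γ(d)` by the lattice polytopes. -/
def Lambda (d : ℕ) : SimpleGraph {P : Polytope d // P.IsLattice} :=
  (Gamma d).induce {P : Polytope d | P.IsLattice}

/-- The subgraph induced in `Λ(d)` by the simplices and the polytopes with `d + 2` vertices. -/
def LambdaSimplex (d : ℕ) :
    SimpleGraph {P : {P : Polytope d // P.IsLattice} //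
      P.1.IsSimplex ∨ P.1.vertices.ncard = d + 2} :=
  (Lambda d).induce {P : {P : Polytope d // P.IsLattice} |
    P.1.IsSimplex ∨ P.1.vertices.ncard = d + 2}

end PolytopeMoves

/-! ### Lattice vertex sets and chains of insertions -/

namespace PolytopeMoves

variable {d : ℕ}

/-! A full-dimensional lattice polytope has d + 1 affinely independent vertices. Convex independence
passes to subsets, so its other vertices can be deleted one by one, leaving a lattice simplex. Both
claims thus reduce to joining lattice simplices through polytopes with d + 2 vertices
(`Frame.joined`).

A Steinitz exchange reduces this further to replacing one vertex `b i` of a simplex by a lattice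
point `q` off the opposite facet hyperplane. If `q` has a negative and two positive barycentric
coordinates, `q` and the simplex are in convex position: insert `q`, then delete `b i`
(`joined_update_of_signs`). Otherwise a detour through a lattice point `z` with `i`-th coordinate 1
is made. If `q` is on the same side as `b i`, `z` is `b i` pushed far along `b j - b k`, which has
good signs for both simplices. If `q` is on the other side, reduction modulo the `i`-th coordinate
of `q` gives a `z` whose simplex sees `q` with good signs. Three distinct indices are needed, whence
`d ≥ 2`. -/

/-- All coordinates of `x` are integers. -/
def IsLatticePoint (x : EuclideanSpace ℝ (Fin d)) : Prop :=
  ∀ i : Fin d, ∃ n : ℤ, x i = (n : ℝ)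

/-- The sets that are the vertex set of a `d`-dimensional lattice polytope. -/
structure IsLatticeVertexSet (s : Set (EuclideanSpace ℝ (Fin d))) : Prop where
  finite : s.Finite
  convexIndependent : ConvexIndependent ℝ ((↑) : s → EuclideanSpace ℝ (Fin d))
  affineSpan_eq_top : affineSpan ℝ s = ⊤
  isLatticePoint : ∀ x ∈ s, IsLatticePoint x

theorem convexHull_extremePoints_convexHull {s : Set (EuclideanSpace ℝ (Fin d))}
    (hs : s.Finite) : convexHull ℝ ((convexHull ℝ s).extremePoints ℝ) = convexHull ℝ s := by
  have h := closure_convexHull_extremePoints (hs.isCompact_convexHull ℝ) (convex_convexHull ℝ s)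
  rwa [((hs.subset extremePoints_convexHull_subset).isClosed_convexHull ℝ).closure_eq] at h

theorem extremePoints_convexHull_of_convexIndependent {s : Set (EuclideanSpace ℝ (Fin d))}
    (hs : s.Finite) (hc : ConvexIndependent ℝ ((↑) : s → EuclideanSpace ℝ (Fin d))) :
    (convexHull ℝ s).extremePoints ℝ = s := by
  refine extremePoints_convexHull_subset.antisymm fun x hx => ?_
  by_contra hxe
  refine convexIndependent_set_iff_notMem_convexHull_sdiff.1 hc x hx ?_
  refine convexHull_mono (Set.subset_sdiff_singleton extremePoints_convexHull_subset hxe) ?_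
  rw [convexHull_extremePoints_convexHull hs]
  exact subset_convexHull ℝ s hx

namespace IsLatticeVertexSet

variable {s t : Set (EuclideanSpace ℝ (Fin d))} {x : EuclideanSpace ℝ (Fin d)}

/-- The lattice polytope with a given vertex set. -/
def polytope (hs : IsLatticeVertexSet s) : {P : Polytope d // P.IsLattice} :=
  ⟨⟨convexHull ℝ s, ⟨s, hs.finite, rfl⟩, by
    rw [affineSpan_convexHull, hs.affineSpan_eq_top]⟩, by
    intro v hv
    exact hs.isLatticePoint v (extremePoints_convexHull_subset hv)⟩

theorem vertices_polytope (hs : IsLatticeVertexSet s) : hs.polytope.1.vertices = s :=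
  extremePoints_convexHull_of_convexIndependent hs.finite hs.convexIndependent

theorem mono (ht : IsLatticeVertexSet t) (hst : s ⊆ t) (hs : affineSpan ℝ s = ⊤) :
    IsLatticeVertexSet s where
  finite := ht.finite.subset hst
  convexIndependent := ht.convexIndependent.mono hst
  affineSpan_eq_top := hs
  isLatticePoint x hx := ht.isLatticePoint x (hst hx)

theorem adj_insert (hs : IsLatticeVertexSet s) (ht : IsLatticeVertexSet (insert x s))
    (hx : x ∉ s) : (Lambda d).Adj hs.polytope ht.polytope := by
  have hconv : convexHull ℝ (convexHull ℝ s ∪ {x}) = convexHull ℝ (insert x s) := by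
    rw [convexHull_convexHull_union_left, Set.union_singleton]
  refine Or.inl (Or.inl ⟨x, ⟨fun hxs => ?_, ?_⟩, hconv.symm⟩)
  · refine convexIndependent_set_iff_notMem_convexHull_sdiff.1 ht.convexIndependent x
      (Set.mem_insert x s) ?_
    rwa [Set.insert_sdiff_self_of_notMem hx]
  · change Set.extremePoints ℝ (convexHull ℝ (convexHull ℝ s ∪ {x})) =
      hs.polytope.1.vertices ∪ {x}
    rw [hconv, hs.vertices_polytope, Set.union_singleton]
    exact ht.vertices_polytope

/-- Points are added one at a time: each intermediate set inherits convex independence from `t` and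
full affine span from `s`. -/
theorem reachable_of_subset (hs : IsLatticeVertexSet s) (ht : IsLatticeVertexSet t)
    (hst : s ⊆ t) : (Lambda d).Reachable hs.polytope ht.polytope := by
  obtain ⟨u, rfl⟩ := ht.finite.exists_finset_coe
  obtain ⟨v, rfl⟩ := hs.finite.exists_finset_coe
  classical
  have key : ∀ (w : Finset (EuclideanSpace ℝ (Fin d)))
      (hw : IsLatticeVertexSet (↑(v ∪ w) : Set (EuclideanSpace ℝ (Fin d)))),
      (Lambda d).Reachable hs.polytope hw.polytope := by
    intro w
    induction w using Finset.induction_on with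
    | empty =>
      simp only [Finset.union_empty]
      exact fun _ => .rfl
    | insert a w _ ih =>
      intro hv
      by_cases hav : a ∈ v ∪ w
      · have : v ∪ insert a w = v ∪ w := by
          rw [Finset.union_insert, Finset.insert_eq_of_mem hav]
        simp only [this] at hv ⊢
        exact ih hv
      · have : (↑(v ∪ insert a w) : Set (EuclideanSpace ℝ (Fin d))) = insert a ↑(v ∪ w) := by
          rw [Finset.union_insert, Finset.coe_insert]
        simp only [this] at hv ⊢
        have hvw : IsLatticeVertexSet (↑(v ∪ w) : Set (EuclideanSpace ℝ (Fin d))) := by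
          refine hv.mono (Set.subset_insert _ _) (top_unique ?_)
          rw [← hs.affineSpan_eq_top]
          exact affineSpan_mono ℝ (by exact_mod_cast Finset.subset_union_left)
        exact (ih hvw).trans (hvw.adj_insert hv (by exact_mod_cast hav)).reachable
  have hvu : v ∪ u = u := Finset.union_eq_right.2 (by exact_mod_cast hst)
  have h := key u
  simp only [hvu] at h
  exact h ht

end IsLatticeVertexSet

theorem convexHull_vertices (P : Polytope d) : convexHull ℝ P.vertices = P.1 := by
  obtain ⟨P, ⟨s, hs, rfl⟩, hP⟩ := P
  exact convexHull_extremePoints_convexHull hs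

theorem isLatticeVertexSet_vertices (P : {P : Polytope d // P.IsLattice}) :
    IsLatticeVertexSet P.1.vertices where
  finite := by
    obtain ⟨⟨P, ⟨s, hs, rfl⟩, hP⟩, hl⟩ := P
    exact hs.subset extremePoints_convexHull_subset
  convexIndependent := by
    obtain ⟨⟨P, ⟨s, hs, rfl⟩, hP⟩, hl⟩ := P
    exact (convex_convexHull ℝ s).convexIndependent_extremePoints
  affineSpan_eq_top := by
    rw [← affineSpan_convexHull, convexHull_vertices, P.1.2.2]
  isLatticePoint := P.2

theorem polytope_vertices (P : {P : Polytope d // P.IsLattice}) :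
    (isLatticeVertexSet_vertices P).polytope = P :=
  Subtype.ext (Subtype.ext (convexHull_vertices P.1))

/-! ### Barycentric coordinates and replacement of one point of a frame -/

/-- An affine basis of `ℝ^d` indexed by `Fin (d + 1)`. -/
abbrev Frame (d : ℕ) : Type := AffineBasis (Fin (d + 1)) ℝ (EuclideanSpace ℝ (Fin d))

namespace Frame

theorem coord_apply_eq_sum (b c : Frame d) (l : Fin (d + 1)) (x : EuclideanSpace ℝ (Fin d)) :
    b.coord l x = ∑ m, c.coord m x * b.coord l (c m) := by
  conv_lhs => rw [← c.affineCombination_coord_eq_self x]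
  rw [Finset.map_affineCombination _ _ _ (c.sum_coord_apply_eq_one x),
    Finset.affineCombination_eq_linear_combination _ _ _ (c.sum_coord_apply_eq_one x)]
  simp

theorem coord_sum_smul (b : Frame d) {w : Fin (d + 1) → ℝ} (hw : ∑ i, w i = 1)
    (l : Fin (d + 1)) : b.coord l (∑ i, w i • b i) = w l := by
  rw [← Finset.affineCombination_eq_linear_combination _ _ _ hw,
    b.coord_apply_combination_of_mem (Finset.mem_univ l) hw]

theorem exists_update (b : Frame d) {i : Fin (d + 1)} {q : EuclideanSpace ℝ (Fin d)}
    (hq : b.coord i q ≠ 0) : ∃ c : Frame d, ⇑c = Function.update b i q := by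
  have hind : AffineIndependent ℝ (Function.update b i q) := by
    refine b.ind.affineIndependent_update_of_notMem_affineSpan fun hmem => hq ?_
    have hle : affineSpan ℝ (b '' {x | x ≠ i}) ≤
        (AffineSubspace.mk' (0 : ℝ) ⊥).comap (b.coord i) := by
      rw [affineSpan_le]
      rintro _ ⟨j, hj, rfl⟩
      simp [b.coord_apply_ne (Ne.symm hj)]
    simpa using hle hmem
  refine ⟨⟨_, hind, ?_⟩, rfl⟩
  rw [hind.affineSpan_eq_top_iff_card_eq_finrank_add_one]
  simp

section update

variable {b c : Frame d} {i : Fin (d + 1)} {q : EuclideanSpace ℝ (Fin d)}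

theorem coord_eq_of_update (h : ⇑c = Function.update b i q) (x : EuclideanSpace ℝ (Fin d)) :
    b.coord i x = c.coord i x * b.coord i q := by
  rw [coord_apply_eq_sum b c, Finset.sum_eq_single i]
  · rw [h, Function.update_self]
  · intro m _ hm
    rw [h, Function.update_of_ne hm, b.coord_apply_ne hm.symm, mul_zero]
  · simp

theorem coord_eq_of_update_ne (h : ⇑c = Function.update b i q) {j : Fin (d + 1)} (hj : j ≠ i)
    (x : EuclideanSpace ℝ (Fin d)) :
    b.coord j x = c.coord j x + c.coord i x * b.coord j q := by
  rw [coord_apply_eq_sum b c, ← Finset.sum_subset (Finset.subset_univ {j, i}),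
    Finset.sum_pair hj, h, Function.update_self, Function.update_of_ne hj, b.coord_apply_eq,
    mul_one]
  intro m _ hm
  simp only [Finset.mem_insert, Finset.mem_singleton, not_or] at hm
  rw [h, Function.update_of_ne hm.2, b.coord_apply_ne (Ne.symm hm.1), mul_zero]

end update

/-! ### Lattice frames and their simplices -/

/-- All points of the frame are lattice points. -/
def IsLattice (b : Frame d) : Prop := ∀ i, IsLatticePoint (b i)

theorem IsLattice.isLatticeVertexSet {b : Frame d} (hb : b.IsLattice) :
    IsLatticeVertexSet (Set.range b) where
  finite := Set.finite_range b
  convexIndependent := by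
    refine ConvexIndependent.range fun t i hi => ?_
    exact (b.ind.mem_affineSpan_iff i t).1 (convexHull_subset_affineSpan _ hi)
  affineSpan_eq_top := b.tot
  isLatticePoint := by
    rintro _ ⟨i, rfl⟩
    exact hb i

theorem IsLattice.update {b c : Frame d} (hb : b.IsLattice) {i : Fin (d + 1)}
    {q : EuclideanSpace ℝ (Fin d)} (h : ⇑c = Function.update b i q) (hq : IsLatticePoint q) :
    c.IsLattice := by
  intro j
  rw [h]
  rcases eq_or_ne j i with rfl | hj
  · rwa [Function.update_self]
  · rw [Function.update_of_ne hj]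
    exact hb j

theorem IsLattice.sum_smul {b : Frame d} (hb : b.IsLattice) (w : Fin (d + 1) → ℤ) :
    IsLatticePoint (∑ i, (w i : ℝ) • b i) := by
  intro k
  choose n hn using fun i => hb i k
  refine ⟨∑ i, w i * n i, ?_⟩
  simp [hn]

/-- The sign conditions put at least two points on each side of the Radon partition of the frame and
`q`, so no point lies in the hull of the others. -/
theorem convexIndependent_insert (b : Frame d) {q : EuclideanSpace ℝ (Fin d)}
    {m j k : Fin (d + 1)} (hm : b.coord m q < 0) (hj : 0 < b.coord j q) (hk : 0 < b.coord k q)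
    (hjk : j ≠ k) :
    ConvexIndependent ℝ ((↑) : ↥(insert q (Set.range b)) → EuclideanSpace ℝ (Fin d)) := by
  rw [convexIndependent_set_iff_notMem_convexHull_sdiff]
  rintro x (rfl | ⟨i, rfl⟩) hx
  · have hsub : convexHull ℝ (insert x (Set.range b) \ {x}) ⊆ b.coord m ⁻¹' Set.Ici 0 := by
      refine convexHull_min ?_ ((convex_Ici 0).affine_preimage _)
      rintro y ⟨rfl | ⟨l, rfl⟩, hy⟩
      · exact absurd rfl hy
      · rw [Set.mem_preimage, Set.mem_Ici, b.coord_apply]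
        split_ifs <;> norm_num
    exact absurd (hsub hx) (not_le.2 hm)
  · obtain ⟨l, hl, hli⟩ : ∃ l, 0 < b.coord l q ∧ l ≠ i := by
      rcases eq_or_ne j i with rfl | h
      · exact ⟨k, hk, hjk.symm⟩
      · exact ⟨j, hj, h⟩
    -- This affine function is nonpositive at `q` and at every other frame point, but equals
    -- `b.coord l q > 0` at `b i`; the `max` handles both signs of `b.coord i q`.
    have hsub : convexHull ℝ (insert q (Set.range b) \ {b i}) ⊆
        (b.coord l q • b.coord i - max (b.coord i q) 0 • b.coord l) ⁻¹' Set.Iic 0 := by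
      refine convexHull_min ?_ ((convex_Iic 0).affine_preimage _)
      rintro y ⟨rfl | ⟨n, rfl⟩, hy⟩
      · simp only [Set.mem_preimage, Set.mem_Iic, AffineMap.coe_sub, AffineMap.coe_smul,
          Pi.sub_apply, Pi.smul_apply, smul_eq_mul]
        nlinarith [le_max_left (b.coord i y) 0]
      · have hn : i ≠ n := fun h => hy (by rw [h]; rfl)
        simp only [Set.mem_preimage, Set.mem_Iic, AffineMap.coe_sub, AffineMap.coe_smul,
          Pi.sub_apply, Pi.smul_apply, smul_eq_mul, b.coord_apply_ne hn, mul_zero, zero_sub,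
          neg_nonpos]
        rw [b.coord_apply]
        split_ifs <;> simp
    have := hsub hx
    simp only [Set.mem_preimage, Set.mem_Iic, AffineMap.coe_sub, AffineMap.coe_smul,
      Pi.sub_apply, Pi.smul_apply, smul_eq_mul, b.coord_apply_eq, b.coord_apply_ne hli, mul_one,
      mul_zero, sub_zero] at this
    exact absurd this (not_le.2 hl)

/-- The simplex spanned by a lattice frame. -/
def IsLattice.simplex {b : Frame d} (hb : b.IsLattice) :
    {P : {P : Polytope d // P.IsLattice} // P.1.IsSimplex ∨ P.1.vertices.ncard = d + 2} :=
  ⟨hb.isLatticeVertexSet.polytope, Or.inl (by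
    rw [Polytope.IsSimplex, hb.isLatticeVertexSet.vertices_polytope]
    exact b.ind.range)⟩

theorem ncard_range (b : Frame d) : (Set.range b).ncard = d + 1 := by
  rw [← Set.image_univ, Set.ncard_image_of_injective _ b.ind.injective]
  simp

theorem simplex_eq_of_range_eq {b c : Frame d} (hb : b.IsLattice) (hc : c.IsLattice)
    (h : Set.range b = Set.range c) : hb.simplex = hc.simplex :=
  Subtype.ext (Subtype.ext (Subtype.ext (congrArg (convexHull ℝ) h)))

/-! ### Replacing one vertex of a lattice simplex -/

/-- The simplices spanned by two lattice frames are connected. -/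
def Joined (b c : Frame d) : Prop :=
  ∀ (hb : b.IsLattice) (hc : c.IsLattice), (LambdaSimplex d).Reachable hb.simplex hc.simplex

theorem adj_insert {b : Frame d} (hb : b.IsLattice) {x : EuclideanSpace ℝ (Fin d)}
    (hx : x ∉ Set.range b) {s : Set (EuclideanSpace ℝ (Fin d))} (hs : insert x (Set.range b) = s)
    (hi : IsLatticeVertexSet s) (hcard : hi.polytope.1.vertices.ncard = d + 2) :
    (LambdaSimplex d).Adj hb.simplex ⟨hi.polytope, Or.inr hcard⟩ := by
  subst hs
  exact hb.isLatticeVertexSet.adj_insert hi hx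

/-- Both simplices arise from the same polytope with d + 2 vertices, by deleting `q` or `b i`. -/
theorem joined_update_of_signs {b c : Frame d} {i m j k : Fin (d + 1)}
    {q : EuclideanSpace ℝ (Fin d)} (h : ⇑c = Function.update b i q) (hm : b.coord m q < 0)
    (hj : 0 < b.coord j q) (hk : 0 < b.coord k q) (hjk : j ≠ k) : b.Joined c := by
  intro hb hc
  have hq : q ∉ Set.range b := by
    rintro ⟨l, rfl⟩
    rw [b.coord_apply] at hm
    split_ifs at hm <;> norm_num at hm
  have hqc : q = c i := by rw [h, Function.update_self]
  have hbi : b i ∉ Set.range c := by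
    rintro ⟨l, hl⟩
    rcases eq_or_ne l i with rfl | hli
    · exact hq ⟨l, hl.symm.trans hqc.symm⟩
    · rw [h, Function.update_of_ne hli] at hl
      exact hli (b.ind.injective hl)
  have hins : IsLatticeVertexSet (insert q (Set.range b)) :=
    { finite := (Set.finite_range b).insert q
      convexIndependent := b.convexIndependent_insert hm hj hk hjk
      affineSpan_eq_top := top_unique (b.tot ▸ affineSpan_mono ℝ (Set.subset_insert _ _))
      isLatticePoint := by
        rintro x (rfl | ⟨l, rfl⟩)
        · rw [hqc]
          exact hc i
        · exact hb l }
  have hcard : hins.polytope.1.vertices.ncard = d + 2 := by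
    rw [hins.vertices_polytope, Set.ncard_insert_of_notMem hq (Set.finite_range b), b.ncard_range]
  have hset : insert (b i) (Set.range c) = insert q (Set.range b) := by
    refine Set.Subset.antisymm ?_ ?_
    · rintro x (rfl | ⟨l, rfl⟩)
      · exact Or.inr ⟨i, rfl⟩
      · rcases eq_or_ne l i with rfl | hl
        · exact Or.inl hqc.symm
        · exact Or.inr ⟨l, by rw [h, Function.update_of_ne hl]⟩
    · rintro x (rfl | ⟨l, rfl⟩)
      · exact Or.inr ⟨i, hqc.symm⟩
      · rcases eq_or_ne l i with rfl | hl
        · exact Or.inl rfl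
        · exact Or.inr ⟨l, by rw [h, Function.update_of_ne hl]⟩
  exact (adj_insert hb hq rfl hins hcard).reachable.trans
    (adj_insert hc hbi hset hins hcard).reachable.symm

theorem Joined.symm {b c : Frame d} (h : b.Joined c) : c.Joined b :=
  fun hc hb => (h hb hc).symm

theorem Joined.trans {a b c : Frame d} (h : a.Joined b) (h' : b.Joined c) (hb : b.IsLattice) :
    a.Joined c :=
  fun ha hc => (h ha hb).trans (h' hb hc)

theorem joined_update_of_pos {b c : Frame d} {i j k : Fin (d + 1)}
    (hij : i ≠ j) (hik : i ≠ k) (hjk : j ≠ k) {q : EuclideanSpace ℝ (Fin d)}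
    (h : ⇑c = Function.update b i q) (hq : 0 < b.coord i q) : b.Joined c := by
  intro hb
  -- In `c`, the point `z = b i + M (b j - b k)` has `j`- and `k`-coordinates those of `b i` shifted
  -- by `M` and `-M`; this `M` makes them positive and negative.
  obtain ⟨M, hM⟩ := exists_nat_gt
    (max 0 (max (-c.coord j (b i)) (c.coord k (b i))))
  simp only [max_lt_iff] at hM
  obtain ⟨hM0, hMj, hMk⟩ := hM
  let w : Fin (d + 1) → ℤ := Pi.single i 1 + Pi.single j (M : ℤ) - Pi.single k (M : ℤ)
  have hwi : w i = 1 := by simp [w, hij, hik]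
  have hwj : w j = M := by simp [w, hij.symm, hjk]
  have hwk : w k = -M := by simp [w, hik.symm, hjk.symm]
  have hw : ∑ l, (w l : ℝ) = 1 := by
    rw [← Int.cast_sum]
    simp [w, Finset.sum_add_distrib]
  set z := ∑ l, (w l : ℝ) • b l
  have hzl : ∀ l, b.coord l z = w l := fun l => b.coord_sum_smul hw l
  have hzi : b.coord i z = 1 := by rw [hzl, hwi, Int.cast_one]
  have hzlat : IsLatticePoint z := hb.sum_smul w
  obtain ⟨b', hb'⟩ := b.exists_update (i := i) (q := z) (by rw [hzi]; exact one_ne_zero)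
  have hcb : ⇑b' = Function.update c i z := by rw [hb', h, Function.update_idem]
  have hbc : ⇑b = Function.update c i (b i) := by
    rw [h, Function.update_idem, Function.update_eq_self]
  have hci : 0 < c.coord i (b i) := by
    have := coord_eq_of_update h (b i)
    rw [b.coord_apply_eq] at this
    exact pos_of_mul_pos_left (this ▸ one_pos) hq.le
  have hczi : c.coord i z = c.coord i (b i) := by
    rw [coord_eq_of_update hbc, hzi, one_mul]
  have hcz : ∀ l, l ≠ i → c.coord l z = w l + c.coord l (b i) := by
    intro l hl
    rw [coord_eq_of_update_ne hbc hl, hzi, one_mul, hzl]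
  have h₁ : b.Joined b' := by
    refine joined_update_of_signs hb' (m := k) (j := i) (k := j) ?_ ?_ ?_ hij
    · rw [hzl, hwk]; push_cast; linarith
    · rw [hzi]; exact one_pos
    · rw [hzl, hwj]; exact_mod_cast hM0
  have h₂ : c.Joined b' := by
    refine joined_update_of_signs hcb (m := k) (j := i) (k := j) ?_ ?_ ?_ hij
    · rw [hcz k hik.symm, hwk]; push_cast; linarith
    · rwa [hczi]
    · rw [hcz j hij.symm, hwj]; push_cast; linarith
  exact h₁.trans h₂.symm (hb.update hb' hzlat) hb

theorem exists_int_add_mul_mem_Ioc (x : ℝ) {r : ℝ} (hr : 0 < r) :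
    ∃ n : ℤ, 0 < x + n * r ∧ x + n * r ≤ r := by
  obtain ⟨n, hn, -⟩ := existsUnique_add_zsmul_mem_Ioc hr x 0
  refine ⟨n, ?_⟩
  simpa using hn

theorem joined_update_of_neg {b c : Frame d} {i j k : Fin (d + 1)}
    (hij : i ≠ j) (hik : i ≠ k) (hjk : j ≠ k) {q : EuclideanSpace ℝ (Fin d)}
    (h : ⇑c = Function.update b i q) (hq : b.coord i q < 0) : b.Joined c := by
  intro hb
  set r := -b.coord i q with hr
  have hr0 : 0 < r := by linarith
  choose n hn hn' using fun l => exists_int_add_mul_mem_Ioc (b.coord l q) hr0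
  -- Replacing `b i` by `z` turns the `l`-th coordinate of `q` into `b.coord l q + w l * r`. The
  -- choice `n j` puts it in `(0, r]`, while `n l - 1` makes it nonpositive; the weight at `k` is
  -- then forced by the total 1.
  let u : Fin (d + 1) → ℤ := fun l => if l = i then 1 else if l = j then n j else n l - 1
  let w : Fin (d + 1) → ℤ := Function.update u k (1 - ∑ l ∈ Finset.univ.erase k, u l)
  have hwk : ∀ l, l ≠ k → w l = u l := fun l hl => Function.update_of_ne hl _ _
  have hw : ∑ l, (w l : ℝ) = 1 := by
    rw [← Int.cast_sum, ← Finset.add_sum_erase _ _ (Finset.mem_univ k),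
      Finset.sum_congr rfl fun l hl => hwk l (Finset.ne_of_mem_erase hl)]
    simp [w]
  have hwi : w i = 1 := by rw [hwk i hik]; simp [u]
  have hwj : w j = n j := by rw [hwk j hjk]; simp [u, hij.symm]
  have hwl : ∀ l, l ≠ i → l ≠ j → l ≠ k → w l = n l - 1 := by
    intro l hi hj hk
    rw [hwk l hk]
    simp [u, hi, hj]
  set z := ∑ l, (w l : ℝ) • b l
  have hzl : ∀ l, b.coord l z = w l := fun l => b.coord_sum_smul hw l
  have hzi : b.coord i z = 1 := by rw [hzl, hwi, Int.cast_one]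
  have hzlat : IsLatticePoint z := hb.sum_smul w
  obtain ⟨b', hb'⟩ := b.exists_update (i := i) (q := z) (by rw [hzi]; exact one_ne_zero)
  have hcb : ⇑c = Function.update b' i q := by rw [hb', h, Function.update_idem]
  have hqi : b'.coord i q = -r := by
    have := coord_eq_of_update hb' q
    rw [hzi, mul_one] at this
    rw [← this, hr, neg_neg]
  have hql : ∀ l, l ≠ i → b'.coord l q = b.coord l q + w l * r := by
    intro l hl
    have := coord_eq_of_update_ne hb' hl q
    rw [hqi, hzl] at this
    linarith
  have hqj : 0 < b'.coord j q ∧ b'.coord j q ≤ r := by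
    rw [hql j hij.symm, hwj]
    exact ⟨hn j, hn' j⟩
  have hqk : 0 < b'.coord k q := by
    -- Otherwise the coordinates of `q` would sum to at most `-r + r = 0` instead of 1.
    by_contra hk
    have hsum : ∑ l, b'.coord l q ≤ ∑ l, ((Pi.single i (-r) : Fin (d + 1) → ℝ) l +
        (Pi.single j r : Fin (d + 1) → ℝ) l) := by
      refine Finset.sum_le_sum fun l _ => ?_
      rcases eq_or_ne l i with rfl | hi
      · simp [hij, hqi]
      rcases eq_or_ne l j with rfl | hj
      · simpa [hi] using hqj.2
      rcases eq_or_ne l k with rfl | hlk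
      · simpa [hi, hj] using hk
      · rw [hql l hi, hwl l hi hj hlk]
        simp only [Pi.single_eq_of_ne hi, Pi.single_eq_of_ne hj]
        push_cast
        linarith [hn' l]
    rw [b'.sum_coord_apply_eq_one, Finset.sum_add_distrib, Finset.sum_pi_single',
      Finset.sum_pi_single'] at hsum
    simp only [Finset.mem_univ, if_true] at hsum
    linarith
  have h₁ : b.Joined b' := joined_update_of_pos hij hik hjk hb' (hzi ▸ one_pos)
  have h₂ : b'.Joined c :=
    joined_update_of_signs hcb (m := i) (hqi ▸ neg_neg_of_pos hr0) hqj.1 hqk hjk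
  exact h₁.trans h₂ (hb.update hb' hzlat) hb

theorem joined_update (hd : 2 ≤ d) {b c : Frame d} {i : Fin (d + 1)}
    {q : EuclideanSpace ℝ (Fin d)} (h : ⇑c = Function.update b i q) (hq : b.coord i q ≠ 0) :
    b.Joined c := by
  obtain ⟨j, hj⟩ : ∃ j, j ∉ ({i} : Finset (Fin (d + 1))) :=
    Finset.exists_mem_notMem_of_card_lt_card (s := {i}) (t := Finset.univ)
      (by rw [Finset.card_singleton, Finset.card_fin]; omega) |>.imp fun _ h => h.2
  obtain ⟨k, hk⟩ : ∃ k, k ∉ ({i, j} : Finset (Fin (d + 1))) :=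
    Finset.exists_mem_notMem_of_card_lt_card (s := {i, j}) (t := Finset.univ)
      (Finset.card_le_two.trans_lt (by rw [Finset.card_fin]; omega)) |>.imp fun _ h => h.2
  simp only [Finset.mem_insert, Finset.mem_singleton, not_or] at hj hk
  rcases hq.lt_or_gt with hq | hq
  · exact joined_update_of_neg (Ne.symm hj) (Ne.symm hk.1) (Ne.symm hk.2) h hq
  · exact joined_update_of_pos (Ne.symm hj) (Ne.symm hk.1) (Ne.symm hk.2) h hq

/-! ### Exchange between two lattice simplices -/

theorem joined (hd : 2 ≤ d) (b c : Frame d) : b.Joined c := by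
  induction hN : (Set.range c \ Set.range b).ncard using Nat.strong_induction_on generalizing b with
  | _ N ih =>
  intro hb hc
  by_cases hsub : Set.range c ⊆ Set.range b
  · have hrange : Set.range c = Set.range b :=
      Set.eq_of_subset_of_ncard_le hsub (by rw [ncard_range, ncard_range]) (Set.finite_range b)
    rw [simplex_eq_of_range_eq hb hc hrange.symm]
  · obtain ⟨_, ⟨j, rfl⟩, hj⟩ := Set.not_subset.1 hsub
    -- A nonzero term of this expansion of 1 picks the vertex to exchange: the factor `b.coord i (c
    -- j)` keeps the new points affinely independent, and `c.coord j (b i)` shows that `b i` is not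
    -- a point of `c`, so no common vertex is lost.
    have hsum := c.coord_apply_eq_sum b j (c j)
    rw [c.coord_apply_eq] at hsum
    obtain ⟨i, -, hi⟩ := Finset.exists_ne_zero_of_sum_ne_zero (hsum ▸ one_ne_zero)
    have hbi : b i ∉ Set.range c := by
      rintro ⟨l, hl⟩
      rw [← hl] at hi
      rcases eq_or_ne j l with rfl | hjl
      · exact hj ⟨i, hl.symm⟩
      · exact hi (by rw [c.coord_apply_ne hjl, mul_zero])
    have hne : b.coord i (c j) ≠ 0 := left_ne_zero_of_mul hi
    obtain ⟨b', hb'⟩ := b.exists_update hne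
    have hlt : (Set.range c \ Set.range b').ncard < N := by
      rw [← hN]
      refine Set.ncard_lt_ncard ⟨?_, fun hle => ?_⟩ ((Set.finite_range c).sdiff)
      · rintro x ⟨hx, hxb⟩
        refine ⟨hx, ?_⟩
        rintro ⟨l, rfl⟩
        rcases eq_or_ne l i with rfl | hl
        · exact hbi hx
        · exact hxb ⟨l, by rw [hb', Function.update_of_ne hl]⟩
      · exact (hle ⟨⟨j, rfl⟩, hj⟩).2 ⟨i, by rw [hb', Function.update_self]⟩
    exact (joined_update hd hb' hne).trans (ih _ hlt b' rfl) (hb.update hb' (hc j)) hb hc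

end Frame

/-! ### Reduction of polytopes to simplices, and connectedness -/

theorem exists_frame {s : Set (EuclideanSpace ℝ (Fin d))} (hs : affineSpan ℝ s = ⊤) :
    ∃ b : Frame d, Set.range b ⊆ s := by
  obtain ⟨t, hts, hspan, hind⟩ := exists_affineIndependent ℝ (EuclideanSpace ℝ (Fin d)) s
  have htop : affineSpan ℝ t = ⊤ := hspan.trans hs
  let B : AffineBasis t ℝ (EuclideanSpace ℝ (Fin d)) :=
    ⟨((↑) : t → EuclideanSpace ℝ (Fin d)), hind, by rwa [Subtype.range_coe]⟩
  have : Finite t := finite_set_of_fin_dim_affineIndependent ℝ hind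
  have := Fintype.ofFinite t
  have hcard : Fintype.card t = d + 1 := by
    have h := B.card_eq_finrank_add_one
    rwa [finrank_euclideanSpace_fin] at h
  refine ⟨B.reindex (Fintype.equivFinOfCardEq hcard), ?_⟩
  rintro _ ⟨i, rfl⟩
  exact hts (Subtype.coe_prop _)

theorem exists_isLattice_frame (d : ℕ) : ∃ b : Frame d, b.IsLattice := by
  have hspan : affineSpan ℝ {x : EuclideanSpace ℝ (Fin d) | IsLatticePoint x} = ⊤ := by
    have h0 : (0 : EuclideanSpace ℝ (Fin d)) ∈ {x | IsLatticePoint x} := fun i => ⟨0, by simp⟩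
    rw [AffineSubspace.affineSpan_eq_top_iff_vectorSpan_eq_top_of_nonempty _ _ _ ⟨0, h0⟩,
      ← top_le_iff, ← (EuclideanSpace.basisFun (Fin d) ℝ).toBasis.span_eq, Submodule.span_le]
    rintro _ ⟨i, rfl⟩
    rw [← sub_zero ((EuclideanSpace.basisFun (Fin d) ℝ).toBasis i)]
    refine vsub_mem_vectorSpan ℝ (fun j => ?_) h0
    rcases eq_or_ne j i with rfl | hj
    · exact ⟨1, by simp⟩
    · exact ⟨0, by simp [hj]⟩
  obtain ⟨b, hb⟩ := exists_frame hspan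
  exact ⟨b, fun i => hb ⟨i, rfl⟩⟩

theorem exists_isLattice_frame_reachable (P : {P : Polytope d // P.IsLattice}) :
    ∃ (b : Frame d) (hb : b.IsLattice),
      (Lambda d).Reachable hb.isLatticeVertexSet.polytope P := by
  have hP := isLatticeVertexSet_vertices P
  obtain ⟨b, hbs⟩ := exists_frame hP.affineSpan_eq_top
  have hb : b.IsLattice := fun i => hP.isLatticePoint _ (hbs ⟨i, rfl⟩)
  refine ⟨b, hb, ?_⟩
  have h := hb.isLatticeVertexSet.reachable_of_subset hP hbs
  rwa [polytope_vertices] at h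

theorem exists_simplex_reachable
    (P : {P : {P : Polytope d // P.IsLattice} //
      P.1.IsSimplex ∨ P.1.vertices.ncard = d + 2}) :
    ∃ (b : Frame d) (hb : b.IsLattice), (LambdaSimplex d).Reachable hb.simplex P := by
  obtain ⟨P, hcase⟩ := P
  have hP := isLatticeVertexSet_vertices P
  obtain ⟨b, hbs⟩ := exists_frame hP.affineSpan_eq_top
  have hb : b.IsLattice := fun i => hP.isLatticePoint _ (hbs ⟨i, rfl⟩)
  refine ⟨b, hb, ?_⟩
  rcases hcase with h | h
  · have hrange : Set.range b = P.1.vertices := by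
      refine hbs.antisymm fun v hv => by_contra fun hvb => ?_
      -- A vertex outside the frame would lie in the span of the other vertices, since the frame
      -- already spans everything.
      refine AffineIndependent.notMem_affineSpan_sdiff h ⟨v, hv⟩ Set.univ
        (affineSpan_mono (s₁ := Set.range b) ℝ ?_ (b.tot ▸ AffineSubspace.mem_top _ _ _))
      intro y hy
      exact ⟨⟨y, hbs hy⟩, ⟨trivial, fun hyv => hvb ((Subtype.mk.inj hyv) ▸ hy)⟩, rfl⟩
    have : hb.simplex = ⟨P, Or.inl h⟩ := by
      refine Subtype.ext (Subtype.ext (Subtype.ext ?_))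
      rw [← convexHull_vertices P.1, ← hrange]
      rfl
    rw [this]
  · obtain ⟨x, hx, hins⟩ : ∃ x ∉ Set.range b, insert x (Set.range b) = P.1.vertices := by
      simpa only [exists_prop] using (Set.exists_eq_insert_iff_ncard (Set.finite_range b)).2
        ⟨hbs, by rw [b.ncard_range, h]⟩
    have := Frame.adj_insert hb hx hins hP (by rw [polytope_vertices, h])
    simp only [polytope_vertices] at this
    exact this.reachable

theorem lambdaSimplex_connected (hd : 2 ≤ d) : (LambdaSimplex d).Connected := by
  obtain ⟨b₀, hb₀⟩ := exists_isLattice_frame d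
  have : Nonempty {P : {P : Polytope d // P.IsLattice} //
      P.1.IsSimplex ∨ P.1.vertices.ncard = d + 2} := ⟨hb₀.simplex⟩
  refine ⟨fun P Q => ?_⟩
  obtain ⟨b, hb, hbP⟩ := exists_simplex_reachable P
  obtain ⟨c, hc, hcQ⟩ := exists_simplex_reachable Q
  exact hbP.symm.trans ((b.joined hd c hb hc).trans hcQ)

theorem lambda_connected (hd : 2 ≤ d) : (Lambda d).Connected := by
  obtain ⟨b₀, hb₀⟩ := exists_isLattice_frame d
  have : Nonempty {P : Polytope d // P.IsLattice} := ⟨hb₀.simplex.1⟩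
  refine ⟨fun P Q => ?_⟩
  obtain ⟨b, hb, hbP⟩ := exists_isLattice_frame_reachable P
  obtain ⟨c, hc, hcQ⟩ := exists_isLattice_frame_reachable Q
  have h := (b.joined hd c hb hc).map (SimpleGraph.Embedding.induce _).toHom
  exact hbP.symm.trans (h.trans hcQ)

end PolytopeMoves

theorem mainTheorem5 (d : ℕ) (hd : 2 ≤ d) :
    (PolytopeMoves.Lambda d).Connected ∧ (PolytopeMoves.LambdaSimplex d).Connected :=
  ⟨PolytopeMoves.lambda_connected hd, PolytopeMoves.lambdaSimplex_connected hd⟩
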